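/- Let $(X,d)$ be a compact metric space and $T:X\to X$ a continuous map whose eventual image $X_\infty:=\bigcap_{i\ge 1}T^i(X)$ contains more than one point. Suppose that $(X,T)$ has the (weak) specification property: for every $\varepsilon>0$ there is an integer $u_\varepsilon\ge 0$ such that for any $n\ge 1$, any points $x^{(1)},\dots,x^{(n)}\in X_\infty$ and any lengths $r_1,\dots,r_n\ge 1$ there is a point $z\in X_\infty$ with $$d\bigl(T^{s_i+j}z,\;T^{j}x^{(i)}\bigr)<\varepsilon\qquad\text{for all }1\le i\le n,\ 0\le j<r_i,$$ where $s_i:=\sum_{k<i}(r_k+u_\varepsilon)$. Then $(X,T)$ is Bohr chaotic: for every bounded real sequence $(a_n)_{n\ge 0}$ with $\limsup_{N\to\infty}\frac1N\sum_{n=0}^{N-1}|a_n|>0$ there exist a point $x\in X$ and a continuous function $f:X\to\mathbb{R}$ such that $$\limsup_{N\to\infty}\frac1N\Bigl|\sum_{n=0}^{N-1}a_n f(T^n x)\Bigr|>0.$$ -/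

import Mathlib

open Filter Topology

namespace BohrChaos

/-- The eventual image `⋂_{i ≥ 1} T^i(X)` of a self-map `T` of `X`. -/
def eventualImage {X : Type*} (T : X → X) : Set X :=
  ⋂ i : ℕ, ⋂ _ : 1 ≤ i, Set.range (T^[i])

/-- The orbit segment `z, T z, …, T^(r-1) z` `ε`-shadows the sequence `w 0, …, w (r-1)`. -/
def Shadows {X : Type*} [MetricSpace X] (T : X → X) (ε : ℝ) (r : ℕ) (z : X) (w : ℕ → X) : Prop :=
  ∀ j < r, dist (T^[j] z) (w j) < ε

/-- The (weak) specification property: for every `ε > 0` there is a gap length `u` such that any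
finitely many (nonempty) orbit segments in the eventual image, the `i`-th one starting at `x i` and
having length `r i`, are successively `ε`-shadowed along the orbit of one point `z` of the eventual
image, with gaps of length exactly `u` between consecutive segments. -/
def HasSpecification {X : Type*} [MetricSpace X] (T : X → X) : Prop :=
  ∀ ε : ℝ, 0 < ε → ∃ u : ℕ, ∀ (n : ℕ) (x : ℕ → X) (r : ℕ → ℕ),
    (∀ i < n, x i ∈ eventualImage T) → (∀ i < n, 1 ≤ r i) →
      ∃ z ∈ eventualImage T, ∀ i < n,
        Shadows T ε (r i) (T^[∑ k ∈ Finset.range i, (r k + u)] z) (fun j => T^[j] (x i))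

/-- A real sequence is non-trivial if `limsup_N (1/N) ∑_{n<N} |a n| > 0`
(used for bounded sequences only). -/
def NontrivialSeq (a : ℕ → ℝ) : Prop :=
  0 < limsup (fun N : ℕ => (1 / (N : ℝ)) * ∑ n ∈ Finset.range N, |a n|) atTop

/-- Bohr chaos: every bounded non-trivial real sequence correlates with the sequence
`f (T^n x)`, for some point `x` and some continuous real function `f`.
Compactness of `X` makes `f` bounded, so that all limsups are of bounded sequences. -/
def IsBohrChaotic {X : Type*} [TopologicalSpace X] [CompactSpace X] (T : X → X) : Prop :=
  ∀ a : ℕ → ℝ, (∃ C : ℝ, ∀ n, |a n| ≤ C) → NontrivialSeq a →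
    ∃ (x : X) (f : C(X, ℝ)),
      0 < limsup (fun N : ℕ => (1 / (N : ℝ)) * |∑ n ∈ Finset.range N, a n * f (T^[n] x)|) atTop

end BohrChaos

/-!
The idea is to build a continuous `f : X → [0, 1]`, a period `P` and a constant `c > 0` such that,
for *every* set `A` of multiples of `P`, some orbit has `f ≥ c` at the times in `A` and `f = 0` at
all other times (`HasSpecification.exists_isolated_marker`). Since the total mass of `|a n|` has
positive upper density, so has that of the positive part of `σ * a n` along one residue class
modulo `P`, for some sign `σ` (`NontrivialSeq.exists_residue_class`). Switching the marker on exactly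
where `σ * a n > 0` in that class gives an orbit along which nothing cancels.

The difficulty is that specification says nothing about the orbit during the gaps, so that the
marker must be recognised by its whole itinerary. There are points `q`, `p` of the eventual image
with `p` away from the forward orbit of `q` (`HasSpecification.exists_orbit_avoiding`). This follows
from a diagonal argument: a point that shadows one orbit segment over and over has, outside the
gaps, one of finitely many prescribed itineraries, while specification provides a point which
differs from each of them outside the gaps. The marker is the orbit segment of a point `z` which at
the multiples of `L` is near `p, …, p, q, p, …, p`, with `m` copies of `p` on each side. It cannot be
mistaken for itself shifted by `0 < k ≤ m`: iterating such a coincidence `L` times would bring `q`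
near `p`. It cannot be seen at a larger distance from its place either, since its first or its last
time would fall where the orbit follows `q`, away from `p`. The precision `δ` of the first argument
depends on `L` but not on `m`, so `m` may be chosen larger than the gap length that belongs to `δ`;
this is what makes the two arguments cover all shifts.
-/

namespace BohrChaos

/-! ### Shadowing infinitely many orbit segments -/

theorem isClosed_eventualImage {X : Type*} [MetricSpace X] [CompactSpace X] {T : X → X}
    (hT : Continuous T) : IsClosed (eventualImage T) :=
  isClosed_iInter fun i => isClosed_iInter fun _ => (isCompact_range (hT.iterate i)).isClosed

theorem exists_iterate_eq_of_mem_eventualImage {X : Type*} {T : X → X} {y : X}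
    (hy : y ∈ eventualImage T) (t : ℕ) : ∃ x, T^[t] x = y := by
  rcases Nat.eq_zero_or_pos t with rfl | ht
  · exact ⟨y, rfl⟩
  · exact Set.mem_iInter₂.1 hy t ht

variable {X : Type*} [MetricSpace X]

/-- By compactness, specification extends to infinite sequences of orbit segments, at the price of a
non-strict inequality. Segments of a common length `r` suffice below. -/
theorem HasSpecification.exists_shadowing [CompactSpace X] {T : X → X} (hT : Continuous T)
    (hS : HasSpecification T) {ε : ℝ} (hε : 0 < ε) :
    ∃ u : ℕ, ∀ (r : ℕ) (ξ : ℕ → X), 1 ≤ r → (∀ i, ξ i ∈ eventualImage T) →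
      ∃ z ∈ eventualImage T, ∀ i, ∀ j < r,
        dist (T^[i * (r + u) + j] z) (T^[j] (ξ i)) ≤ ε := by
  obtain ⟨u, hu⟩ := hS ε hε
  refine ⟨u, fun r ξ hr hξ => ?_⟩
  let A : ℕ → Set X := fun n => eventualImage T ∩
    {z | ∀ i < n, ∀ j < r, dist (T^[i * (r + u) + j] z) (T^[j] (ξ i)) ≤ ε}
  have hA : ∀ n, IsClosed (A n) := fun n => by
    refine (isClosed_eventualImage hT).inter ?_
    simp only [Set.ofPred_forall]
    exact isClosed_iInter fun i => isClosed_iInter fun _ => isClosed_iInter fun j =>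
      isClosed_iInter fun _ => isClosed_le ((hT.iterate _).dist continuous_const) continuous_const
  have hne : ∀ n, (A n).Nonempty := fun n => by
    obtain ⟨z, hz, hsh⟩ := hu n ξ (fun _ => r) (fun i _ => hξ i) (fun _ _ => hr)
    refine ⟨z, hz, fun i hi j hj => ?_⟩
    have h := hsh i hi j hj
    simp only [Finset.sum_const, Finset.card_range, smul_eq_mul] at h
    rw [add_comm, Function.iterate_add_apply]
    exact h.le
  obtain ⟨z, hz⟩ := IsCompact.nonempty_iInter_of_sequence_nonempty_isCompact_isClosed A
    (fun n z hz => ⟨hz.1, fun i hi => hz.2 i (hi.trans n.lt_succ_self)⟩) hne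
    (hA 0).isCompact hA
  rw [Set.mem_iInter] at hz
  exact ⟨z, (hz 0).1, fun i => (hz (i + 1)).2 i i.lt_succ_self⟩

/-- The point `q` shadows `a` periodically with segments longer than the gaps, and the itinerary of
`p` relative to `a`, `b` differs from that of `T^[t] q` for each of the finitely many phases of `t`;
so `p` is not in the closure of the orbit of `q`. -/
theorem HasSpecification.exists_orbit_avoiding [CompactSpace X] {T : X → X} (hT : Continuous T)
    (hS : HasSpecification T) (hE : (eventualImage T).Nontrivial) :
    ∃ q ∈ eventualImage T, ∃ p ∈ eventualImage T, ∃ ρ > 0, ∀ t, ρ ≤ dist (T^[t] q) p := by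
  classical
  obtain ⟨a, ha, b, hb, hab⟩ := hE
  obtain ⟨ε, hε, hε6⟩ : ∃ ε > 0, 6 * ε = dist a b :=
    ⟨dist a b / 6, by have := dist_pos.2 hab; positivity, by ring⟩
  obtain ⟨u, hu⟩ := hS.exists_shadowing hT hε
  obtain ⟨q, hq, hqa⟩ := hu (u + 1) (fun _ => a) (by omega) (fun _ => ha)
  -- The period of the shadowing of `a` by `q`. Indices `2 * t` and `2 * t + 1` of the sequence `η`
  -- contradict the itinerary of `q` seen from phase `t`.
  let L := 2 * u + 1
  let η : ℕ → X := fun i => if dist (T^[(i / 2 + i * (u + 1)) % L] a) a ≤ 3 * ε then b else a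
  obtain ⟨p, hp, hpη⟩ := hu 1 η le_rfl
    (fun i => by simp only [η]; split_ifs <;> assumption)
  let W := 2 * L * (u + 1)
  have key : ∀ τ, ∃ j < W, ε ≤ dist (T^[j] (T^[τ] q)) (T^[j] p) := by
    intro τ
    set t := τ % L with ht
    have htL : t < L := Nat.mod_lt _ (by omega)
    -- Consecutive sampling times differ by `u + 1`, so they do not both fall in a gap.
    obtain ⟨i, hi2, hi⟩ : ∃ i, i / 2 = t ∧ (t + i * (u + 1)) % L < u + 1 := by
      by_cases h : (t + 2 * t * (u + 1)) % L < u + 1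
      · exact ⟨2 * t, by omega, h⟩
      · refine ⟨2 * t + 1, by omega, ?_⟩
        have hlt : (t + 2 * t * (u + 1)) % L < L := Nat.mod_lt _ (by omega)
        have h1 : t + (2 * t + 1) * (u + 1) = (t + 2 * t * (u + 1)) + (u + 1) := by ring
        rw [h1, Nat.add_mod, Nat.mod_eq_of_lt (show u + 1 < L by omega),
          Nat.mod_eq_sub_mod (by omega), Nat.mod_eq_of_lt (by omega)]
        omega
    refine ⟨i * (u + 1), Nat.mul_lt_mul_of_pos_right (by omega) (by omega), ?_⟩
    by_contra! hlt
    set e := (t + i * (u + 1)) % L with he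
    have h1 : dist (T^[i * (u + 1)] (T^[τ] q)) (T^[e] a) ≤ ε := by
      rw [← Function.iterate_add_apply]
      have h2 := hqa ((i * (u + 1) + τ) / L) e hi
      have h3 : (i * (u + 1) + τ) / L * (u + 1 + u) + e = i * (u + 1) + τ := by
        have h4 : e = (i * (u + 1) + τ) % L := by
          rw [he, ht, Nat.mod_add_mod, add_comm]
        rw [h4, show u + 1 + u = L by omega]
        exact Nat.div_add_mod' _ _
      rwa [h3] at h2
    have h2 : dist (T^[i * (u + 1)] p) (η i) ≤ ε := by
      have := hpη i 0 one_pos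
      rwa [add_zero, add_comm 1 u] at this
    have h3 : dist (T^[e] a) (η i) < 3 * ε := by
      have := dist_triangle4 (T^[e] a) (T^[i * (u + 1)] (T^[τ] q)) (T^[i * (u + 1)] p) (η i)
      rw [dist_comm (T^[e] a) (T^[i * (u + 1)] _)] at this
      linarith
    have h4 : η i = if dist (T^[e] a) a ≤ 3 * ε then b else a := by simp only [η, hi2, he]
    rw [h4] at h3
    split_ifs at h3 with h5
    · have := dist_triangle_left a b (T^[e] a)
      linarith
    · exact h5 h3.le
  have hcont : ∀ᶠ w in 𝓝 p, ∀ j ∈ Finset.range W, dist (T^[j] w) (T^[j] p) < ε :=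
    (Filter.eventually_all_finset _).2 fun j _ =>
      (hT.iterate j).continuousAt.eventually (Metric.ball_mem_nhds _ hε)
  obtain ⟨ρ, hρ, hball⟩ := Metric.eventually_nhds_iff.1 hcont
  refine ⟨q, hq, p, hp, ρ, hρ, fun τ => ?_⟩
  by_contra! hlt
  obtain ⟨j, hj, hjd⟩ := key τ
  exact absurd (hball hlt j (Finset.mem_range.2 hj)) (not_lt.2 hjd)

/-! ### Isolated markers -/

/-- A continuous function detecting whether `w, T w, …, T^(S-1) w` stays `2 * δ`-close to
`z, T z, …, T^(S-1) z`: it vanishes otherwise, and is bounded below if the segments are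
`δ`-close. -/
noncomputable def orbitBump {T : X → X} (hT : Continuous T) (δ : ℝ) (S : ℕ) (z : X) : C(X, ℝ) where
  toFun w := ∏ j ∈ Finset.range S, max 0 (1 - dist (T^[j] w) (T^[j] z) / (2 * δ))
  continuous_toFun := continuous_finsetProd _ fun j _ =>
    continuous_const.max (continuous_const.sub
      (((hT.iterate j).dist continuous_const).div_const _))

section orbitBump

variable {T : X → X} (hT : Continuous T) {δ : ℝ} {S : ℕ} {z w : X}

theorem orbitBump_apply : orbitBump hT δ S z w =
    ∏ j ∈ Finset.range S, max 0 (1 - dist (T^[j] w) (T^[j] z) / (2 * δ)) :=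
  rfl

theorem orbitBump_nonneg : 0 ≤ orbitBump hT δ S z w := by
  rw [orbitBump_apply]
  exact Finset.prod_nonneg fun _ _ => le_max_left _ _

theorem orbitBump_le_one (hδ : 0 < δ) : orbitBump hT δ S z w ≤ 1 := by
  rw [orbitBump_apply]
  exact Finset.prod_le_one (fun _ _ => le_max_left _ _) fun _ _ =>
    max_le zero_le_one (sub_le_self _ (by positivity))

theorem half_pow_le_orbitBump (hδ : 0 < δ) (h : ∀ j < S, dist (T^[j] w) (T^[j] z) ≤ δ) :
    (1 / 2) ^ S ≤ orbitBump hT δ S z w := by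
  have : ∏ _j ∈ Finset.range S, (1 / 2 : ℝ) ≤ orbitBump hT δ S z w := by
    refine Finset.prod_le_prod (fun _ _ => by norm_num) fun j hj => le_max_of_le_right ?_
    have h1 := h j (Finset.mem_range.1 hj)
    have : dist (T^[j] w) (T^[j] z) / (2 * δ) ≤ 1 / 2 := by
      rw [div_le_iff₀ (by positivity)]; linarith
    linarith
  simpa using this

theorem dist_lt_of_orbitBump_ne_zero (hδ : 0 < δ) (h : orbitBump hT δ S z w ≠ 0) {j : ℕ}
    (hj : j < S) : dist (T^[j] w) (T^[j] z) < 2 * δ := by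
  by_contra! hle
  refine h (Finset.prod_eq_zero (Finset.mem_range.2 hj) (max_eq_left ?_))
  have : 1 ≤ dist (T^[j] w) (T^[j] z) / (2 * δ) := by
    rwa [le_div_iff₀ (by positivity), one_mul]
  linarith

end orbitBump

/-- The times in `A` that are multiples of `P` can be marked independently of each other: some orbit
meets the support of `f` exactly then. -/
theorem HasSpecification.exists_isolated_marker [CompactSpace X] {T : X → X} (hT : Continuous T)
    (hS : HasSpecification T) (hE : (eventualImage T).Nontrivial) :
    ∃ P > 0, ∃ c > 0, ∃ f : C(X, ℝ), (∀ w, 0 ≤ f w ∧ f w ≤ 1) ∧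
      ∀ A : Set ℕ, ∃ y ∈ eventualImage T, (∀ n ∈ A, P ∣ n → c ≤ f (T^[n] y)) ∧
        ∀ n, ¬ (n ∈ A ∧ P ∣ n) → f (T^[n] y) = 0 := by
  classical
  obtain ⟨q, hq, p, hp, ρ, hρ, hqp⟩ := hS.exists_orbit_avoiding hT hE
  -- Two points within `ε` of `p` and of the orbit of `q` are more than `ε` apart.
  obtain ⟨ε, hε, hε4⟩ : ∃ ε > 0, 4 * ε = ρ := ⟨ρ / 4, by positivity, by ring⟩
  obtain ⟨u₀, hu₀⟩ := hS.exists_shadowing hT hε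
  set L := 1 + u₀ with hL
  have hLpos : (1 : ℝ) ≤ L := by rw [hL]; push_cast; linarith [(Nat.cast_nonneg u₀ : (0:ℝ) ≤ u₀)]
  -- Small enough that `L` consecutive errors of `3 * δ` stay below `ε`.
  obtain ⟨δ, hδ, hδL⟩ : ∃ δ > 0, L * (3 * δ) = ε / 2 :=
    ⟨ε / (6 * L), by positivity, by field_simp; norm_num⟩
  have hδ3 : 3 * δ ≤ ε / 2 := by nlinarith
  obtain ⟨u, hu⟩ := hS.exists_shadowing hT hδ
  -- With `m > u`, a window shifted by more than `m` reaches past a gap at one of its ends.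
  set m := u + 1 with hm
  obtain ⟨z, hz, hzη⟩ := hu₀ 1 (fun i => if i = m then q else p) le_rfl
    (fun i => by split_ifs <;> assumption)
  have hzp : ∀ i, i ≠ m → dist (T^[i * L] z) p ≤ ε := fun i hi => by
    simpa [hi] using hzη i 0 one_pos
  have hzq : dist (T^[m * L] z) q ≤ ε := by simpa using hzη m 0 one_pos
  set S := 2 * m * L + 1 with hSdef
  have hmL : m ≤ 2 * m * L := by nlinarith
  -- The marker does not overlap itself at a shift `k ≤ m`.
  have hself : ∀ k, 1 ≤ k → k ≤ m →
      ¬ ∀ j, j + k < S → dist (T^[j + k] z) (T^[j] z) ≤ 3 * δ := by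
    intro k hk1 hkm hov
    have hiter : ∀ a ≤ L, dist (T^[m * L + a * k] z) (T^[m * L] z) ≤ a * (3 * δ) := by
      intro a
      induction a with
      | zero => intro _; simp
      | succ a ih =>
        intro ha
        have h1 := ih (by omega)
        have h2 := hov (m * L + a * k) (by
          have : (a + 1) * k ≤ L * m := Nat.mul_le_mul ha hkm
          rw [hSdef]; nlinarith)
        rw [show m * L + (a + 1) * k = m * L + a * k + k by ring]
        have := dist_triangle (T^[m * L + a * k + k] z) (T^[m * L + a * k] z) (T^[m * L] z)
        push_cast
        linarith
    have h1 := hiter L le_rfl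
    rw [show m * L + L * k = (m + k) * L by ring, hδL] at h1
    have h2 := hzp (m + k) (by omega)
    have h3 := hqp 0
    rw [Function.iterate_zero_apply] at h3
    have h4 := dist_triangle4 q (T^[m * L] z) (T^[(m + k) * L] z) p
    rw [dist_comm q (T^[m * L] z), dist_comm (T^[m * L] z) (T^[(m + k) * L] z)] at h4
    linarith
  -- Even blocks carry the marker or follow `q`; odd blocks follow `q` and separate the markers.
  set B := S + u with hB
  refine ⟨2 * B, by omega, (1 / 2) ^ S, by positivity, orbitBump hT δ S z,
    fun w => ⟨orbitBump_nonneg hT, orbitBump_le_one hT hδ⟩, fun A => ?_⟩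
  obtain ⟨y, hy, hyξ⟩ := hu S (fun b => if 2 ∣ b ∧ b * B ∈ A then z else q) (by omega)
    (fun b => by split_ifs <;> assumption)
  have hyz : ∀ i, 2 * B * i ∈ A → ∀ j < S, dist (T^[j] (T^[2 * B * i] y)) (T^[j] z) ≤ δ := by
    intro i hi j hj
    have h := hyξ (2 * i) j hj
    have e : 2 * i * B = 2 * B * i := by ring
    rw [if_pos ⟨dvd_mul_right _ _, by rwa [e]⟩, ← hB, e, add_comm,
      Function.iterate_add_apply] at h
    exact h
  -- Times at which the orbit of `y` follows the orbit of `q` are far from `p`.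
  have hfar : ∀ b j, j < S → ¬ (2 ∣ b ∧ b * B ∈ A) → ∀ i, i ≠ m →
      2 * δ ≤ dist (T^[b * B + j] y) (T^[i * L] z) := by
    intro b j hj hb i hi
    have h := hyξ b j hj
    rw [if_neg hb, ← hB] at h
    have h1 := hqp j
    have h2 := hzp i hi
    have h3 := dist_triangle4 (T^[j] q) (T^[b * B + j] y) (T^[i * L] z) p
    rw [dist_comm (T^[j] q) (T^[b * B + j] y)] at h3
    linarith
  refine ⟨y, hy, ?_, ?_⟩
  · rintro _ hn ⟨i, rfl⟩
    exact half_pow_le_orbitBump hT hδ (hyz i hn)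
  · intro n hn
    by_contra hne
    have hvis : ∀ j < S, dist (T^[n + j] y) (T^[j] z) < 2 * δ := fun j hj => by
      rw [add_comm, Function.iterate_add_apply]
      exact dist_lt_of_orbitBump_ne_zero hT hδ hne hj
    have hv0 : ∀ b j, j < S → b * B + j = n → (2 ∣ b ∧ b * B ∈ A) := by
      intro b j hj e
      by_contra hb
      have h1 := hfar b j hj hb 0 (by omega)
      have h2 := hvis 0 (by omega)
      rw [e] at h1
      simp only [add_zero, zero_mul] at h1 h2
      linarith
    have hv1 : ∀ b j, j < S → b * B + j = n + 2 * m * L → (2 ∣ b ∧ b * B ∈ A) := by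
      intro b j hj e
      by_contra hb
      have h1 := hfar b j hj hb (2 * m) (by omega)
      have h2 := hvis (2 * m * L) (by omega)
      rw [e] at h1
      linarith
    obtain ⟨i, k, hk, rfl⟩ : ∃ i k, k < 2 * B ∧ 2 * B * i + k = n :=
      ⟨n / (2 * B), n % (2 * B), Nat.mod_lt _ (by omega), Nat.div_add_mod _ _⟩
    have e0 : 2 * i * B = 2 * B * i := by ring
    have e1 : (2 * i + 1) * B = 2 * B * i + B := by ring
    have e2 : (2 * i + 2) * B = 2 * B * i + 2 * B := by ring
    have e3 : 2 * B * (i + 1) = 2 * B * i + 2 * B := by ring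
    rcases Nat.lt_or_ge m k with hmk | hmk
    · rcases Nat.lt_or_ge k (2 * B - m) with hk2 | hk2
      · -- The first or the last time of the window `[n, n + S)` lies in the odd block.
        rcases Nat.lt_or_ge k B with hkB | hkB
        · have := (hv1 (2 * i + 1) (k + 2 * m * L - B) (by omega) (by omega)).1
          omega
        · have := (hv0 (2 * i + 1) (k - B) (by omega) (by omega)).1
          omega
      · -- The window overlaps the next even block up to a shift of at most `m`.
        have hact := (hv1 (2 * i + 2) (2 * m * L - (2 * B - k)) (by omega) (by omega)).2
        rw [e2, ← e3] at hact
        refine hself (2 * B - k) (by omega) (by omega) fun j hj => ?_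
        have h1 := hyz (i + 1) hact j (by omega)
        have h2 := hvis (j + (2 * B - k)) hj
        rw [← Function.iterate_add_apply] at h1
        rw [show 2 * B * i + k + (j + (2 * B - k)) = j + 2 * B * (i + 1) by omega] at h2
        have := dist_triangle_left (T^[j + (2 * B - k)] z) (T^[j] z) (T^[j + 2 * B * (i + 1)] y)
        linarith
    · -- The window overlaps the current even block up to a shift of at most `m`.
      have hact := (hv0 (2 * i) k (by omega) (by omega)).2
      rw [e0] at hact
      have hk0 : k ≠ 0 := by
        rintro rfl
        exact hn ⟨hact, dvd_mul_right _ _⟩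
      refine hself k (by omega) hmk fun j hj => ?_
      have h1 := hyz i hact (j + k) hj
      have h2 := hvis j (by omega)
      rw [← Function.iterate_add_apply] at h1
      rw [show 2 * B * i + k + j = j + k + 2 * B * i by ring] at h2
      have := dist_triangle_left (T^[j + k] z) (T^[j] z) (T^[j + k + 2 * B * i] y)
      linarith

/-! ### Choice of a residue class and a sign -/

theorem NontrivialSeq.exists_residue_class {a : ℕ → ℝ} (ha : NontrivialSeq a) {P : ℕ}
    (hP : 0 < P) : ∃ t < P, ∃ σ : ℝ, |σ| = 1 ∧ ∃ κ > 0, ∃ᶠ N : ℕ in atTop,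
      κ * N ≤ ∑ n ∈ Finset.range N, if n % P = t then max (σ * a n) 0 else 0 := by
  unfold NontrivialSeq at ha
  obtain ⟨κ, hκ, hκl⟩ := exists_between ha
  have hfr := frequently_lt_of_lt_limsup
    (isCoboundedUnder_le_of_le atTop (x := 0) fun N => by positivity) hκl
  by_contra! hcon
  have hev : ∀ σ : ℝ, |σ| = 1 → ∀ᶠ N : ℕ in atTop, ∀ t ∈ Finset.range P,
      (∑ n ∈ Finset.range N, if n % P = t then max (σ * a n) 0 else 0) < κ / (2 * P) * N :=
    fun σ hσ => (Filter.eventually_all_finset _).2 fun t ht => by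
      have := hcon t (Finset.mem_range.1 ht) σ hσ (κ / (2 * P)) (by positivity)
      simpa using this
  obtain ⟨N, ⟨⟨hN, h1⟩, h2⟩, hN0⟩ := ((hfr.and_eventually (hev 1 (by simp))).and_eventually
    (hev (-1) (by simp))).and_eventually (eventually_gt_atTop 0) |>.exists
  have hsplit : ∀ σ : ℝ, ∑ n ∈ Finset.range N, max (σ * a n) 0 =
      ∑ t ∈ Finset.range P, ∑ n ∈ Finset.range N,
        if n % P = t then max (σ * a n) 0 else 0 := by
    intro σ
    rw [Finset.sum_comm]
    refine Finset.sum_congr rfl fun n _ => ?_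
    rw [Finset.sum_ite_eq, if_pos (Finset.mem_range.2 (Nat.mod_lt _ hP))]
  have hle : ∀ σ : ℝ, (∀ t ∈ Finset.range P, (∑ n ∈ Finset.range N,
      if n % P = t then max (σ * a n) 0 else 0) < κ / (2 * P) * N) →
      ∑ n ∈ Finset.range N, max (σ * a n) 0 ≤ κ / 2 * N := by
    intro σ h
    rw [hsplit]
    refine (Finset.sum_le_card_nsmul _ _ _ fun t ht => (h t ht).le).trans_eq ?_
    rw [Finset.card_range, nsmul_eq_mul]
    field_simp
  have habs : ∑ n ∈ Finset.range N, |a n| =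
      ∑ n ∈ Finset.range N, max (1 * a n) 0 + ∑ n ∈ Finset.range N, max (-1 * a n) 0 := by
    rw [← Finset.sum_add_distrib]
    refine Finset.sum_congr rfl fun n _ => ?_
    rw [one_mul, neg_one_mul]
    exact (posPart_add_negPart (a n)).symm
  have hN' : (0 : ℝ) < N := by exact_mod_cast hN0
  rw [one_div, inv_mul_eq_div, lt_div_iff₀ hN'] at hN
  linarith [hle 1 h1, hle (-1) h2]

end BohrChaos

open BohrChaos in
theorem theorem4p2p1 {X : Type*} [MetricSpace X] [CompactSpace X] (T : X → X)
    (hT : Continuous T) (hE : (BohrChaos.eventualImage T).Nontrivial)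
    (hS : BohrChaos.HasSpecification T) :
    BohrChaos.IsBohrChaotic T := by
  rintro a ⟨C, hC⟩ ha
  have hC0 : 0 ≤ C := (abs_nonneg _).trans (hC 0)
  obtain ⟨P, hP, c, hc, f, hf, hmark⟩ := hS.exists_isolated_marker hT hE
  obtain ⟨t, ht, σ, hσ, κ, hκ, hfreq⟩ := ha.exists_residue_class hP
  obtain ⟨y, hy, hact, hina⟩ := hmark {n | 0 < σ * a (n + t)}
  obtain ⟨x, rfl⟩ := exists_iterate_eq_of_mem_eventualImage hy t
  refine ⟨x, f, ?_⟩
  have hσa : ∀ n, |σ * a n| ≤ C := fun n => by rw [abs_mul, hσ, one_mul]; exact hC n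
  -- Before time `t` the orbit of `x` is not controlled, and each term may cost `C`.
  have hterm : ∀ n, c * (if n % P = t then max (σ * a n) 0 else 0) - (if n < t then C else 0) ≤
      σ * a n * f (T^[n] x) := by
    intro n
    rcases Nat.lt_or_ge n t with hn | hn
    · rw [if_neg (by rw [Nat.mod_eq_of_lt (hn.trans ht)]; exact hn.ne), if_pos hn]
      have h1 : |σ * a n * f (T^[n] x)| ≤ C := by
        rw [abs_mul, abs_of_nonneg (hf _).1]
        exact (mul_le_of_le_one_right (abs_nonneg _) (hf _).2).trans (hσa n)
      linarith [neg_le_of_abs_le h1]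
    · obtain ⟨k, rfl⟩ := Nat.exists_eq_add_of_le' hn
      have hmod : (k + t) % P = t ↔ P ∣ k := by
        rw [← Nat.modEq_zero_iff_dvd]
        constructor
        · intro h
          refine Nat.ModEq.add_right_cancel' t ?_
          rw [zero_add, Nat.ModEq, h, Nat.mod_eq_of_lt ht]
        · intro h
          have := h.add_right t
          rwa [zero_add, Nat.ModEq, Nat.mod_eq_of_lt ht] at this
      rw [if_neg (not_lt.2 hn), sub_zero, Function.iterate_add_apply]
      by_cases hk : 0 < σ * a (k + t) ∧ P ∣ k
      · rw [if_pos (hmod.2 hk.2), max_eq_left hk.1.le, mul_comm]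
        exact mul_le_mul_of_nonneg_left (hact k hk.1 hk.2) hk.1.le
      · rw [hina k hk, mul_zero]
        split_ifs with h
        · rw [max_eq_right (not_lt.1 fun h' => hk ⟨h', hmod.1 h⟩), mul_zero]
        · rw [mul_zero]
  have hsum : ∀ N, c * (∑ n ∈ Finset.range N, if n % P = t then max (σ * a n) 0 else 0) - t * C ≤
      |∑ n ∈ Finset.range N, a n * f (T^[n] x)| := by
    intro N
    have h1 := Finset.sum_le_sum fun n (_ : n ∈ Finset.range N) => hterm n
    rw [Finset.sum_sub_distrib, ← Finset.mul_sum] at h1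
    have h2 : ∑ n ∈ Finset.range N, (if n < t then C else 0) ≤ t * C := by
      rw [← Finset.sum_filter, Finset.sum_const, nsmul_eq_mul]
      refine mul_le_mul_of_nonneg_right ?_ hC0
      have h3 : (Finset.range N).filter (· < t) ⊆ Finset.range t := fun n hn =>
        Finset.mem_range.2 (Finset.mem_filter.1 hn).2
      exact_mod_cast (Finset.card_le_card h3).trans_eq (Finset.card_range t)
    have h3 : ∑ n ∈ Finset.range N, σ * a n * f (T^[n] x) ≤
        |∑ n ∈ Finset.range N, a n * f (T^[n] x)| := by
      simp_rw [mul_assoc]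
      rw [← Finset.mul_sum]
      refine (le_abs_self _).trans_eq ?_
      rw [abs_mul, hσ, one_mul]
    linarith
  have hbdd : IsBoundedUnder (· ≤ ·) atTop
      (fun N : ℕ => (1 / (N : ℝ)) * |∑ n ∈ Finset.range N, a n * f (T^[n] x)|) := by
    refine isBoundedUnder_of ⟨C, fun N => ?_⟩
    rw [one_div, inv_mul_eq_div]
    refine div_le_of_le_mul₀ (Nat.cast_nonneg _) hC0 ?_
    refine (Finset.abs_sum_le_sum_abs _ _).trans ?_
    refine (Finset.sum_le_card_nsmul _ _ C fun n _ => ?_).trans_eq ?_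
    · rw [abs_mul, abs_of_nonneg (hf _).1]
      exact (mul_le_of_le_one_right (abs_nonneg _) (hf _).2).trans (hC n)
    · rw [Finset.card_range, nsmul_eq_mul, mul_comm]
  refine (show 0 < c * κ / 2 by positivity).trans_le (le_limsup_of_frequently_le ?_ hbdd)
  -- For large `N` the at most `t * C` lost before time `t` is half of the gain.
  obtain ⟨N₀, hN₀⟩ := exists_nat_ge (t * C / (c * κ / 2))
  refine (hfreq.and_eventually (eventually_ge_atTop (N₀ + 1))).mono fun N hN => ?_
  have hN1 : (N₀ : ℝ) + 1 ≤ N := by exact_mod_cast hN.2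
  have hNpos : (0 : ℝ) < N := by linarith [(Nat.cast_nonneg N₀ : (0 : ℝ) ≤ N₀)]
  rw [one_div, inv_mul_eq_div, le_div_iff₀ hNpos]
  have h1 := mul_le_mul_of_nonneg_left hN.1 hc.le
  have h2 : t * C ≤ c * κ / 2 * N := by
    rw [div_le_iff₀ (by positivity)] at hN₀
    nlinarith [show 0 < c * κ by positivity]
  linarith [hsum N]
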